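/- Let $S$ be a scheme, $G$ an $S$-group scheme, and $X$ a noetherian $S$-scheme with a left $G$-action $a\colon G\times_S X\to X$ such that the second projection $p_2\colon G\times_S X\to X$ is flat. A $(G,\mathcal O_X)$-module is an $\mathcal O_X$-module $\mathcal M$ with a $G$-linearization, that is, an isomorphism $\Phi\colon a^*\mathcal M\to p_2^*\mathcal M$ satisfying the usual cocycle condition on $G\times_S G\times_S X$. A $(G,\mathcal O_X)$-submodule of $\mathcal M$ is a quasi-coherent submodule $\mathcal N$ with $\Phi(a^*\mathcal N)=p_2^*\mathcal N$, and a $G$-ideal is a quasi-coherent ideal $\mathcal I\subset\mathcal O_X$ whose extensions to $\mathcal O_{G\times_S X}$ along $a$ and along $p_2$ agree. For a quasi-coherent ideal $\mathfrak a$ let $\mathfrak a^*$ be the largest $G$-ideal contained in $\mathfrak a$. A $G$-ideal is $G$-prime if it equals $\mathfrak p^*$ for the ideal $\mathfrak p$ of some integral closed subscheme of $X$, and the $G$-radical $\sqrt[G]{\mathcal I}$ of an ideal $\mathcal I$ is the largest $G$-ideal contained in every $G$-prime containing $\mathcal I$ (it is $\mathcal O_X$ if there are none). Let $\mathcal M$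 be a coherent $(G,\mathcal O_X)$-module. A $(G,\mathcal O_X)$-submodule $\mathcal Q\neq\mathcal M$ of $\mathcal M$ is $G$-primary if for all $(G,\mathcal O_X)$-submodules $\mathcal L\subset\mathcal M$ and all $G$-ideals $\mathcal I$ with $\mathcal I\mathcal L\subset\mathcal Q$ and $\mathcal L\not\subset\mathcal Q$ one has $\mathcal I\subset\sqrt[G]{\mathcal Q:\mathcal M}$. A minimal $G$-primary decomposition of a $(G,\mathcal O_X)$-submodule $\mathcal N$ of $\mathcal M$ is an expression $\mathcal N=\mathcal Q_1\cap\dots\cap\mathcal Q_r$ ($r\ge 0$, the empty intersection being $\mathcal M$) with all $\mathcal Q_i$ $G$-primary, $\bigcap_{j\ne i}\mathcal Q_j\neq\mathcal N$ for every $i$, and $\mathcal P_i:=\sqrt[G]{\mathcal Q_i:\mathcal M}$ pairwise distinct. Let $\mathcal N=\mathcal Q_1\cap\dots\cap\mathcal Q_r=\mathcal Q'_1\cap\dots\cap\mathcal Q'_s$ be two minimal $G$-primary decompositions of $\mathcal N$ in $\mathcal M$, with $\mathcal P_i=\sqrt[G]{\mathcal Q_i:\mathcal M}$ and $\mathcal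 P'_j=\sqrt[G]{\mathcal Q'_j:\mathcal M}$. Then: (1) $\{\mathcal P_1,\dots,\mathcal P_r\}=\{\mathcal P'_1,\dots,\mathcal P'_s\}$ (the set of $G$-associated $G$-primes). (2) If $\Omega$ is a poset ideal of $\{\mathcal P_1,\dots,\mathcal P_r\}$ with respect to inclusion (that is, $\mathcal P_i\subset\mathcal P_k\in\Omega$ implies $\mathcal P_i\in\Omega$), then $\bigcap_{\mathcal P_i\in\Omega}\mathcal Q_i=\bigcap_{\mathcal P'_j\in\Omega}\mathcal Q'_j$. (3) In particular, if $\mathcal P_i$ is a minimal element of $\{\mathcal P_1,\dots,\mathcal P_r\}$ (a minimal $G$-prime), then $\mathcal Q_i=\mathcal Q'_j$ for the index $j$ with $\mathcal P'_j=\mathcal P_i$. -/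

import Mathlib

open CategoryTheory MonoidalCategory CartesianMonoidalCategory AlgebraicGeometry
open scoped MonObj

universe u

namespace GPrimary

noncomputable section

/-! ### Quasi-coherent submodules -/

/-- A sheaf of modules on a (locally noetherian) scheme is coherent if it is quasi-coherent and its
sections over every affine open form a finitely generated module. -/
structure IsCoherent {Y : Scheme.{u}} (M : Y.Modules) : Prop where
  isQuasicoherent : M.IsQuasicoherent
  finite_sections (U : Y.affineOpens) : Module.Finite Γ(Y, U) Γ(M, U)

/-- The data of a quasi-coherent submodule `N` of a quasi-coherent sheaf of modules `M`, in the
style of `AlgebraicGeometry.Scheme.IdealSheafData`: a submodule `N(U)` of `Γ(M, U)` for every affine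
open `U` such that `N(D(f))` is generated by the restrictions of the elements of `N(U)`,
i.e. `N(D(f)) = N(U)_f` inside `Γ(M, D(f)) = Γ(M, U)_f`. -/
@[ext]
structure QCohSubmodule {Y : Scheme.{u}} (M : Y.Modules) where
  sections : ∀ U : Y.affineOpens, Submodule Γ(Y, U) Γ(M, U)
  span_basicOpen : ∀ (U : Y.affineOpens) (f : Γ(Y, U)),
    Submodule.span Γ(Y, Y.affineBasicOpen f)
        ((fun x => M.presheaf.map
            (homOfLE (show (Y.affineBasicOpen f).1 ≤ U.1 from Y.basicOpen_le f)).op x) ''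
          (sections U : Set Γ(M, U))) =
      sections (Y.affineBasicOpen f)

namespace QCohSubmodule

variable {Y : Scheme.{u}} {M : Y.Modules}

/-- Inclusion of submodules. -/
instance : PartialOrder (QCohSubmodule M) :=
  PartialOrder.lift sections fun _ _ => QCohSubmodule.ext

/-- The containment `I L ⊆ N` for an ideal sheaf `I`. -/
def SMulLE (I : Y.IdealSheafData) (L N : QCohSubmodule M) : Prop :=
  ∀ U : Y.affineOpens, I.ideal U • L.sections U ≤ N.sections U

/-- The colon ideal `N : M`, the largest (quasi-coherent) ideal `I` with `I M ⊆ N`. -/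
def colon (N : QCohSubmodule M) : Y.IdealSheafData :=
  Scheme.IdealSheafData.ofIdeals fun U => (N.sections U).colon Set.univ

/-- The sections over the affine open `V ⊆ f⁻¹(U)` of the image of `f^* N` in `f^* M`, for `U` affine:
the submodule generated by the pullbacks to `V` of the elements of `N(U)`. -/
def pullbackSections {Z : Scheme.{u}} (f : Z ⟶ Y) (N : QCohSubmodule M) (U : Y.affineOpens)
    (V : Z.affineOpens) (hV : V.1 ≤ f ⁻¹ᵁ U.1) :
    Submodule Γ(Z, V) Γ((Scheme.Modules.pullback f).obj M, V) :=
  Submodule.span _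
    ((fun x => ((Scheme.Modules.pullback f).obj M).presheaf.map (homOfLE hV).op
      ((((Scheme.Modules.pullbackPushforwardAdjunction f).unit.app M).app U.1) x)) ''
        (N.sections U : Set Γ(M, U)))

end QCohSubmodule

/-! ### `G`-schemes and `G`-linearized modules -/

variable {S : Scheme.{u}} (G X : Over S) [GrpObj G]

/-- The second projection `p₂ : G × X ⟶ X`. -/
abbrev proj : (G ⊗ X).left ⟶ X.left := (snd G X).left

/-- `μ × 1 : G × G × X ⟶ G × X`. -/
abbrev mulId : (G ⊗ G ⊗ X).left ⟶ (G ⊗ X).left := ((α_ G G X).inv ≫ μ[G] ▷ X).left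

/-- `p₂₃ : G × G × X ⟶ G × X`. -/
abbrev projTail : (G ⊗ G ⊗ X).left ⟶ (G ⊗ X).left := (snd G (G ⊗ X)).left

lemma projTail_proj : projTail G X ≫ proj G X = mulId G X ≫ proj G X := by
  rw [← Over.comp_left, ← Over.comp_left]
  congr 1
  simp

variable [ModObj G X]

/-- The action `a : G × X ⟶ X`. -/
abbrev act : (G ⊗ X).left ⟶ X.left := (γ[G, X]).left

/-- `1 × a : G × G × X ⟶ G × X`. -/
abbrev idAct : (G ⊗ G ⊗ X).left ⟶ (G ⊗ X).left := (G ◁ γ[G, X]).left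

lemma mulId_act : mulId G X ≫ act G X = idAct G X ≫ act G X := by
  rw [← Over.comp_left, ← Over.comp_left]
  congr 1
  have h : μ[G] ▷ X ≫ γ[G, X] = (α_ G G X).hom ≫ G ◁ γ[G, X] ≫ γ[G, X] :=
    ModObj.mul_smul (M := G) X
  rw [Category.assoc, h, Iso.inv_hom_id_assoc]

lemma idAct_proj : idAct G X ≫ proj G X = projTail G X ≫ act G X := by
  rw [← Over.comp_left, ← Over.comp_left]
  congr 1
  simp

open Scheme.Modules in
/-- A `G`-linearization of an `𝒪_X`-module `M`: an isomorphism `Φ : a^* M ≅ p₂^* M` such that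
`(μ × 1)^* Φ` is the composite
`(μ × 1)^* a^* M ≅ (1 × a)^* a^* M ⟶ (1 × a)^* p₂^* M ≅ p₂₃^* a^* M ⟶ p₂₃^* p₂^* M ≅ (μ × 1)^* p₂^* M`
of canonical isomorphisms with `(1 × a)^* Φ` and `p₂₃^* Φ`. -/
structure Linearization (M : X.left.Modules) where
  iso : (pullback (act G X)).obj M ≅ (pullback (proj G X)).obj M
  cocycle :
    (pullback (mulId G X)).map iso.hom =
      (pullbackComp (mulId G X) (act G X)).hom.app M ≫
      (pullbackCongr (mulId_act G X)).hom.app M ≫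
      (pullbackComp (idAct G X) (act G X)).inv.app M ≫
      (pullback (idAct G X)).map iso.hom ≫
      (pullbackComp (idAct G X) (proj G X)).hom.app M ≫
      (pullbackCongr (idAct_proj G X)).hom.app M ≫
      (pullbackComp (projTail G X) (act G X)).inv.app M ≫
      (pullback (projTail G X)).map iso.hom ≫
      (pullbackComp (projTail G X) (proj G X)).hom.app M ≫
      (pullbackCongr (projTail_proj G X)).hom.app M ≫
      (pullbackComp (mulId G X) (proj G X)).inv.app M

variable {G X} in
/-- `N` is a `(G, 𝒪_X)`-submodule of the `G`-linearized module `(M, Φ)`: the isomorphism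
`Φ : a^* M ≅ p₂^* M` maps the image of `a^* N` onto the image of `p₂^* N`. This is tested on the
affine opens `V` of `G × X` which `a` and `p₂` map into affine opens of `X`; they form a basis. -/
def IsGSubmodule {M : X.left.Modules} (Φ : Linearization G X M) (N : QCohSubmodule M) : Prop :=
  ∀ (U U' : X.left.affineOpens) (V : (G ⊗ X).left.affineOpens)
    (hU : V.1 ≤ act G X ⁻¹ᵁ U.1) (hU' : V.1 ≤ proj G X ⁻¹ᵁ U'.1),
    (fun x => Φ.iso.hom.app V.1 x) '' (N.pullbackSections (act G X) U V hU : Set _) =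
      (N.pullbackSections (proj G X) U' V hU' : Set _)

/-! ### `G`-ideals, `G`-primes and `G`-radicals -/

/-- A (quasi-coherent) ideal `I` of `𝒪_X` is a `G`-ideal if its extensions to `G × X` along the
action and along the second projection agree. -/
def IsGIdeal (I : X.left.IdealSheafData) : Prop :=
  I.comap (act G X) = I.comap (proj G X)

/-- `I^*`, the largest `G`-ideal contained in `I` (the sum of all of them). -/
def gCore (I : X.left.IdealSheafData) : X.left.IdealSheafData :=
  sSup {J | IsGIdeal G X J ∧ J ≤ I}

/-- A `G`-ideal `P` is `G`-prime if `P = p^*` for the ideal `p` of an integral closed subscheme of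
`X`; equivalently `V(P)` is the smallest closed `G`-subscheme containing some integral closed
subscheme. -/
def IsGPrime (P : X.left.IdealSheafData) : Prop :=
  IsGIdeal G X P ∧ ∃ p : X.left.IdealSheafData, IsIntegral p.subscheme ∧ gCore G X p = P

/-- The `G`-radical of `I`: the largest `G`-ideal contained in all `G`-primes that contain `I`
(the unit ideal if there are none). -/
def gRadical (I : X.left.IdealSheafData) : X.left.IdealSheafData :=
  gCore G X (sInf {P | IsGPrime G X P ∧ I ≤ P})

/-! ### `G`-primary submodules and decompositions -/

variable {G X} {M : X.left.Modules} (Φ : Linearization G X M)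

/-- `N` is a `G`-primary `(G, 𝒪_X)`-submodule of `M`. -/
structure IsGPrimary (N : QCohSubmodule M) : Prop where
  isGSubmodule : IsGSubmodule Φ N
  ne_top : N.sections ≠ ⊤
  le_gRadical_colon : ∀ (L : QCohSubmodule M) (I : X.left.IdealSheafData),
    IsGSubmodule Φ L → IsGIdeal G X I → QCohSubmodule.SMulLE I L N → ¬ L ≤ N →
      I ≤ gRadical G X N.colon

variable (G) in
/-- The ideal `P`, the `G`-radical of `Q : M`, to which a `G`-primary submodule `Q` belongs. -/
def gPrimeOf (Q : QCohSubmodule M) : X.left.IdealSheafData :=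
  gRadical G X Q.colon

/-- `N = Q₁ ∩ ⋯ ∩ Q_r` is a minimal `G`-primary decomposition: every `Q_i` is `G`-primary, no `Q_i`
can be left out, and the `G`-radicals of the `Q_i : M` are pairwise distinct. -/
structure IsMinimalGPrimaryDecomposition (N : QCohSubmodule M) {r : ℕ}
    (Q : Fin r → QCohSubmodule M) : Prop where
  isGPrimary : ∀ i, IsGPrimary Φ (Q i)
  iInf_eq : ⨅ i, (Q i).sections = N.sections
  irredundant : ∀ i, ⨅ (j) (_ : j ≠ i), (Q j).sections ≠ N.sections
  injective : Function.Injective fun i => gPrimeOf G (Q i)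

end

end GPrimary

/-! The classical uniqueness arguments work with `G`-submodules in place of elements, once colons
and finite intersections stay equivariant. Sections of a pullback over affine opens are a base
change (`isBaseChangeAlong_pullbackMap`). The projection is flat, and so is the action, which
differs from it by a shear automorphism of `G × X`. Flat base change commutes with finite
intersections and, `M` being coherent, with `Q : M`. Hence finite intersections of `G`-submodules
are `G`-submodules and `Q : M` is a `G`-ideal.

Since `X` is noetherian, `Q : M` contains a product of `G`-primes containing it. Applying the
factors to `M` one at a time shows that the `G`-radical `P` of `Q : M` is one of them when `Q` is
`G`-primary (`IsGPrimary.isGPrime_gPrimeOf`). Therefore, if `Q'` is `G`-primary with `G`-prime `P'`,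
`L ⊄ Q'` and `(Q : M) L ⊆ Q'`, then `P ⊆ P'` (`IsGPrimary.gPrimeOf_le_of_colon_smul_le`).

For (1), shrink the intersection of the `Q_k`, `k ≠ i`, to some `L ⊄ N` such that each `j` has `L ⊆
Q'_j` or `(Q'_j : M) L ⊆ N`. Some `Q'_j` does not contain `L`, and the criterion applied in both
directions gives `P_i = P'_j`. For (2), the components outside `Ω` can be dropped from an
intersection lying in `Q'_j` when `P'_j ∈ Ω`, because their `G`-primes are not contained in `P'_j`.
Taking `Ω = {P_i}` gives (3). -/

/-! ### Base change along a ring homomorphism -/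

/-- The `g`-semilinear map `ψ : P → T` exhibits `T` as the base change of `P` along the ring
homomorphism `g`. -/
def IsBaseChangeAlong {A B : Type*} [CommRing A] [CommRing B] (g : A →+* B)
    {P T : Type*} [AddCommGroup P] [Module A P] [AddCommGroup T] [Module B T]
    (ψ : P →ₛₗ[g] T) : Prop :=
  letI := g.toAlgebra
  letI := Module.compHom T g
  haveI : IsScalarTower A B T := ⟨fun a b t => by
    rw [Algebra.smul_def, mul_smul]; rfl⟩
  IsBaseChange B ({ toFun := ψ, map_add' := map_add ψ, map_smul' := map_smulₛₗ ψ } : P →ₗ[A] T)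

lemma IsBaseChangeAlong.of_equiv {A B : Type*} [CommRing A] [CommRing B] {g : A →+* B}
    {P T : Type*} [AddCommGroup P] [Module A P] [AddCommGroup T] [Module B T]
    {P' T' : Type*} [AddCommGroup P'] [Module A P'] [AddCommGroup T'] [Module B T']
    {ψ : P →ₛₗ[g] T} (h : IsBaseChangeAlong g ψ) (ψ' : P' →ₛₗ[g] T')
    (e : P ≃ₗ[A] P') (e' : T ≃ₗ[B] T')
    (H : ∀ x, ψ' (e x) = e' (ψ x)) : IsBaseChangeAlong g ψ' := by
  let := g.toAlgebra
  let := Module.compHom T g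
  let := Module.compHom T' g
  have : IsScalarTower A B T := ⟨fun a b t => by
    rw [Algebra.smul_def, mul_smul]; rfl⟩
  have : IsScalarTower A B T' := ⟨fun a b t => by
    rw [Algebra.smul_def, mul_smul]; rfl⟩
  unfold IsBaseChangeAlong at *
  refine IsBaseChange.of_equiv
    (TensorProduct.AlgebraTensorModule.congr (.refl B B) e.symm ≪≫ₗ h.equiv ≪≫ₗ e') ?_
  intro x
  simp [IsBaseChange.equiv_tmul]
  rw [← H]; simp

/-! ### Pullback of quasi-coherent modules between affine schemes -/

namespace AlgebraicGeometry

variable {A B : CommRingCat.{u}} (φ : A ⟶ B)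

/-- Global sections of the pushforward along `Spec φ` are the restriction of scalars of the global
sections. -/
noncomputable def pushforwardSpecMapCompΓIso :
    Scheme.Modules.pushforward (Spec.map φ) ⋙ moduleSpecΓFunctor (R := A) ≅
      moduleSpecΓFunctor (R := B) ⋙ ModuleCat.restrictScalars φ.hom :=
  NatIso.ofComponents (fun M ↦ ((TopCat.Sheaf.forget _ _ ⋙ (evaluation _ _).obj (.op ⊤)).mapIso
     ((pushforwardCompModulesSpecToSheafIso φ).app M))) (by
      intro M N f
      exact congr((TopCat.Sheaf.forget _ _ ⋙ (evaluation _ _).obj (.op ⊤)).map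
        $((pushforwardCompModulesSpecToSheafIso φ).hom.naturality f)))

/-- The pullback of global sections along `Spec φ`. -/
noncomputable def pullbackUnitTop (M : (Spec A).Modules) :
    Γ(M, ⊤) →ₛₗ[φ.hom] Γ((Scheme.Modules.pullback (Spec.map φ)).obj M, ⊤) where
  toFun x := ((Scheme.Modules.pullbackPushforwardAdjunction (Spec.map φ)).unit.app M).app ⊤ x
  map_add' x y := map_add _ _ _
  map_smul' a x := by
    exact (moduleSpecΓFunctor.map
      ((Scheme.Modules.pullbackPushforwardAdjunction (Spec.map φ)).unit.app M) ≫
        (pushforwardSpecMapCompΓIso φ).hom.app _).hom.map_smul a x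

/-- The functor `P ↦ (Spec φ)^* P~` is left adjoint to global sections as an `A`-module. -/
noncomputable def tildePullbackAdjunction :=
  ((tilde.adjunction (R := A)).comp
    (Scheme.Modules.pullbackPushforwardAdjunction (Spec.map φ))).ofNatIsoRight
      (pushforwardSpecMapCompΓIso φ)

/-- The functor `P ↦ (B ⊗ P)~` is left adjoint to global sections as an `A`-module. -/
noncomputable def extendScalarsTildeAdjunction :=
  (ModuleCat.extendRestrictScalarsAdj φ.hom).comp (tilde.adjunction (R := B))

/-- `(Spec φ)^* P~ ≅ (B ⊗ P)~`. -/
noncomputable def tildePullbackIso :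
    tilde.functor A ⋙ Scheme.Modules.pullback (Spec.map φ) ≅
      ModuleCat.extendScalars φ.hom ⋙ tilde.functor B :=
  (tildePullbackAdjunction φ).leftAdjointUniq (extendScalarsTildeAdjunction φ)

/-- Uniqueness of left adjoints gives an isomorphism compatible with the units; this makes the
abstract isomorphism computable on sections. -/
lemma tildePullbackIso_app_pullbackUnitTop (P : ModuleCat A) (x : P) :
    ((tildePullbackIso φ).hom.app P).app ⊤ (pullbackUnitTop φ (tilde P) (tilde.toOpen P ⊤ x)) =
    tilde.toOpen ((ModuleCat.extendScalars φ.hom).obj P) ⊤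
      ((ModuleCat.extendRestrictScalarsAdj φ.hom).unit.app P x) := by
  have := (tildePullbackAdjunction φ).unit_leftAdjointUniq_hom_app (extendScalarsTildeAdjunction φ) P
  have := congr($this x)
  simp [tildePullbackAdjunction, extendScalarsTildeAdjunction] at this
  exact this

lemma isBaseChangeAlong_extendScalars (P : ModuleCat A)
    (ψ : P →ₛₗ[φ.hom] (ModuleCat.extendScalars φ.hom).obj P)
    (h : ∀ x, ψ x = (ModuleCat.extendRestrictScalarsAdj φ.hom).unit.app P x) :
    IsBaseChangeAlong φ.hom ψ := by
  let := φ.hom.toAlgebra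
  let := Module.compHom ((ModuleCat.extendScalars φ.hom).obj P) φ.hom
  have : IsScalarTower A B ((ModuleCat.extendScalars φ.hom).obj P) := ⟨fun a b t => by
    rw [Algebra.smul_def, mul_smul]; rfl⟩
  let e : TensorProduct A B P ≃ₗ[B] (ModuleCat.extendScalars φ.hom).obj P :=
    { toFun := fun x => x, invFun := fun x => x, map_add' := fun _ _ => rfl,
      map_smul' := fun _ _ => rfl, left_inv := fun _ => rfl, right_inv := fun _ => rfl }
  exact IsBaseChange.of_equiv e fun x => (h x).symm

/-- The global sections of `P~` are `P`. -/
noncomputable def tilde.topEquiv (P : ModuleCat A) : P ≃ₗ[A] Γ(tilde P, ⊤) :=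
  (tilde.isoTop P).toLinearEquiv

/-- The linear equivalence on global sections induced by an isomorphism of modules on `Spec A`. -/
noncomputable def Scheme.Modules.appTopEquiv {M N : (Spec A).Modules} (e : M ≅ N) :
    Γ(M, ⊤) ≃ₗ[A] Γ(N, ⊤) :=
  (moduleSpecΓFunctor.mapIso e).toLinearEquiv

lemma isBaseChangeAlong_pullbackUnitTop_tilde (P : ModuleCat A) :
    IsBaseChangeAlong φ.hom (pullbackUnitTop φ (tilde P)) := by
  let ψ : P →ₛₗ[φ.hom] (ModuleCat.extendScalars φ.hom).obj P :=
    { toFun := (ModuleCat.extendRestrictScalarsAdj φ.hom).unit.app P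
      map_add' := map_add _
      map_smul' := ((ModuleCat.extendRestrictScalarsAdj φ.hom).unit.app P).hom.map_smul }
  let e : (Scheme.Modules.pullback (Spec.map φ)).obj (tilde P) ≅
    tilde ((ModuleCat.extendScalars φ.hom).obj P) := (tildePullbackIso φ).app P
  refine (isBaseChangeAlong_extendScalars φ P ψ fun _ => rfl).of_equiv _ (tilde.topEquiv P)
     (tilde.topEquiv ((ModuleCat.extendScalars φ.hom).obj P) ≪≫ₗ
      (Scheme.Modules.appTopEquiv e).symm) ?_
  intro x
  rw [LinearEquiv.trans_apply, LinearEquiv.eq_symm_apply]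
  exact tildePullbackIso_app_pullbackUnitTop φ P x

lemma isBaseChangeAlong_pullbackUnitTop (M : (Spec A).Modules) [M.IsQuasicoherent] :
    IsBaseChangeAlong φ.hom (pullbackUnitTop φ M) := by
  let c : tilde (moduleSpecΓFunctor.obj M) ≅ M :=
    @asIso _ _ _ _ _ (Scheme.Modules.isIso_fromTildeΓ_of_isQuasicoherent M)
  refine (isBaseChangeAlong_pullbackUnitTop_tilde φ _).of_equiv _
    (Scheme.Modules.appTopEquiv c)
    (Scheme.Modules.appTopEquiv ((Scheme.Modules.pullback (Spec.map φ)).mapIso c)) ?_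
  intro x
  have h := (Scheme.Modules.pullbackPushforwardAdjunction (Spec.map φ)).unit.naturality c.hom
  exact congr(($h).app ⊤ x)

end AlgebraicGeometry

/-! ### Sections of pullbacks over affine opens -/

namespace AlgebraicGeometry
open Scheme.Modules TopologicalSpace
variable {Y Z : Scheme.{u}}

/-- The pullback of sections of `M` over `U` to sections of `f^* M` over `V ⊆ f⁻¹(U)`. -/
noncomputable def pullbackMap (f : Z ⟶ Y) (M : Y.Modules) (U : Y.Opens) (V : Z.Opens)
    (e : V ≤ f ⁻¹ᵁ U) :
    Γ(M, U) →ₛₗ[(f.appLE U V e).hom] Γ((pullback f).obj M, V) where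
  toFun x := ((pullback f).obj M).presheaf.map (homOfLE e).op
    (((pullbackPushforwardAdjunction f).unit.app M).app U x)
  map_add' x y := (congrArg _ (map_add _ x y)).trans (map_add _ _ _)
  map_smul' a x := by
    rw [Hom.app_smul]
    refine (map_smul ((pullback f).obj M) (homOfLE e) (f.app U a) _).trans ?_
    rfl

lemma presheafMap_fromSpec_top {U : Y.Opens} (hU : IsAffineOpen U) (a : Γ(Y, U))
    (h : hU.fromSpec ''ᵁ ⊤ ≤ U) :
    Y.presheaf.map (homOfLE h).op a = (hU.fromSpec.appIso ⊤).inv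
      ((Spec Γ(Y, U)).presheaf.map (Opens.leTop _).op ((Scheme.ΓSpecIso Γ(Y, U)).inv a)) := by
  have : Y.presheaf.map (homOfLE h).op = (Scheme.ΓSpecIso Γ(Y, U)).inv ≫
    (Spec Γ(Y, U)).presheaf.map (Opens.leTop _).op ≫ (hU.fromSpec.appIso ⊤).inv := by
    rw [← Category.assoc, Iso.eq_comp_inv, Scheme.Hom.appIso_hom', Scheme.Hom.map_appLE,
      Scheme.Hom.appLE, IsAffineOpen.fromSpec_app_self, Category.assoc, ← Functor.map_comp]
    rfl
  exact congr($this a)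

/-- Sections over an affine open `U` are global sections of the restriction to `Spec Γ(Y, U)`. -/
noncomputable def restrictFromSpecEquiv (M : Y.Modules) {U : Y.Opens} (hU : IsAffineOpen U) :
    Γ(M, U) ≃ₗ[Γ(Y, U)] Γ(M.restrict hU.fromSpec, ⊤) :=
  have h : hU.fromSpec ''ᵁ ⊤ = U := by simp
  { toFun := fun x => M.presheaf.map (homOfLE h.le).op x
    invFun := fun x => M.presheaf.map (homOfLE h.ge).op x
    map_add' := map_add _
    map_smul' := fun a x => by
      refine (map_smul M (homOfLE h.le) a x).trans ?_
      rw [presheafMap_fromSpec_top]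
      rfl
    left_inv := fun x => by
      have := congr($(M.presheaf.map_comp (homOfLE h.le).op (homOfLE h.ge).op) x)
      exact this.symm.trans congr($(M.presheaf.map_id _) x)
    right_inv := fun x => by
      have := congr($(M.presheaf.map_comp (homOfLE h.ge).op (homOfLE h.le).op) x)
      exact this.symm.trans congr($(M.presheaf.map_id _) x) }

variable {S T : Scheme.{u}} (f : Z ⟶ Y) (i : S ⟶ Y) (j : T ⟶ Z) (g : T ⟶ S)
  [IsOpenImmersion i] [IsOpenImmersion j] (w : g ≫ i = j ≫ f)

/-- The isomorphism of composite pushforwards along a commutative square. -/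
noncomputable def pushforwardCompIso :
    pushforward j ⋙ pushforward f ≅ pushforward g ⋙ pushforward i :=
  pushforwardComp _ _ ≪≫ pushforwardCongr w.symm ≪≫ (pushforwardComp _ _).symm

/-- The adjunction of `j^* f^*` with `g_*` followed by `i_*`. -/
noncomputable def pullbackRestrictAdjunction :=
  ((pullbackPushforwardAdjunction f).comp (restrictAdjunction j)).ofNatIsoRight
    (pushforwardCompIso f i j g w)

/-- The adjunction of `g^* i^*` with `g_*` followed by `i_*`. -/
noncomputable def restrictPullbackAdjunction :=
  (restrictAdjunction i).comp (pullbackPushforwardAdjunction g)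

/-- For open immersions `i`, `j` and a commutative square `g ≫ i = j ≫ f`, the restriction along `j`
of `f^* M` is the pullback along `g` of the restriction of `M` along `i`. -/
noncomputable def pullbackRestrictIso :
    pullback f ⋙ restrictFunctor j ≅ restrictFunctor i ⋙ pullback g :=
  (pullbackRestrictAdjunction f i j g w).leftAdjointUniq (restrictPullbackAdjunction i g)

lemma pullbackRestrictIso_app_unit (M : Y.Modules) (U : Y.Opens) (x : Γ(M, U)) :
   ((pullbackRestrictIso f i j g w).hom.app M).app (g ⁻¹ᵁ i ⁻¹ᵁ U)
      (((pullback f).obj M).presheaf.map (homOfLE (show j ''ᵁ (g ⁻¹ᵁ i ⁻¹ᵁ U) ≤ f ⁻¹ᵁ U by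
        rw [← Scheme.Hom.comp_preimage, w, Scheme.Hom.comp_preimage]; exact j.image_preimage_le _)).op
       (((pullbackPushforwardAdjunction f).unit.app M).app U x)) =
    ((pullbackPushforwardAdjunction g).unit.app (M.restrict i)).app (i ⁻¹ᵁ U)
      (M.presheaf.map (homOfLE (i.image_preimage_le U)).op x) := by
  have := (pullbackRestrictAdjunction f i j g w).unit_leftAdjointUniq_hom_app
    (restrictPullbackAdjunction i g) M
  have := congr(($this).app U x)
  simp only [pullbackRestrictAdjunction, restrictPullbackAdjunction, pushforwardCompIso] at this
  simp at this
  refine Eq.trans ?_ this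
  exact congrArg (((pullbackRestrictIso f i j g w).hom.app M).app (g ⁻¹ᵁ i ⁻¹ᵁ U))
    congr($(((pullback f).obj M).presheaf.map_comp (homOfLE (j.image_preimage_le _)).op
      (eqToHom (by rw [← Scheme.Hom.comp_preimage, w, Scheme.Hom.comp_preimage])).op) _)

/-- Used with `W = ⊤`, which is only propositionally equal to the preimage of `U`. -/
lemma pullbackRestrictIso_app_unit_of_eq (M : Y.Modules) (U : Y.Opens) (x : Γ(M, U))
    (W : S.Opens) (hW : W = i ⁻¹ᵁ U) (h : i ''ᵁ W ≤ U) (h' : j ''ᵁ (g ⁻¹ᵁ W) ≤ f ⁻¹ᵁ U) :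
   ((pullbackRestrictIso f i j g w).hom.app M).app (g ⁻¹ᵁ W)
      (((pullback f).obj M).presheaf.map (homOfLE h').op
       (((pullbackPushforwardAdjunction f).unit.app M).app U x)) =
    ((pullbackPushforwardAdjunction g).unit.app (M.restrict i)).app W
      (M.presheaf.map (homOfLE h).op x) := by
  subst hW
  exact pullbackRestrictIso_app_unit f i j g w M U x

/-- For affine opens `V ⊆ f⁻¹(U)` and `M` quasi-coherent, `Γ(f^* M, V) = Γ(Z, V) ⊗ Γ(M, U)`. -/
theorem isBaseChangeAlong_pullbackMap (M : Y.Modules) [M.IsQuasicoherent] {U : Y.Opens}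
    {V : Z.Opens} (hU : IsAffineOpen U) (hV : IsAffineOpen V) (e : V ≤ f ⁻¹ᵁ U) :
    IsBaseChangeAlong (f.appLE U V e).hom (pullbackMap f M U V e) := by
  have w := IsAffineOpen.SpecMap_appLE_fromSpec f hU hV e
  let κ := pullbackRestrictIso f hU.fromSpec hV.fromSpec (Spec.map (f.appLE U V e)) w
  have hM : (M.restrict hU.fromSpec).IsQuasicoherent := inferInstance
  -- Both sides are moved to the spectra of the coordinate rings, where the affine case applies.
  refine (isBaseChangeAlong_pullbackUnitTop (f.appLE U V e) (M.restrict hU.fromSpec)).of_equiv _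
    (restrictFromSpecEquiv M hU).symm ((appTopEquiv (κ.app M)).symm ≪≫ₗ
      (restrictFromSpecEquiv ((pullback f).obj M) hV).symm) ?_
  intro x
  obtain ⟨x, rfl⟩ := (restrictFromSpecEquiv M hU).surjective x
  rw [LinearEquiv.symm_apply_apply, LinearEquiv.trans_apply, LinearEquiv.eq_symm_apply,
    LinearEquiv.eq_symm_apply]
  refine Eq.trans ?_ (pullbackRestrictIso_app_unit_of_eq f hU.fromSpec hV.fromSpec _ w M U x ⊤
    (by simp) (by simp) ?_)
  · refine congrArg ((κ.hom.app M).app ⊤) ?_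
    exact congr($(((pullback f).obj M).presheaf.map_comp (homOfLE e).op (homOfLE (by simp)).op) _).symm

end AlgebraicGeometry

/-! ### Flat base change of submodules, intersections and colons -/

section
open TensorProduct
variable {A B P Q : Type*} [CommRing A] [CommRing B] [Algebra A B] [AddCommGroup P] [Module A P]
  [AddCommGroup Q] [Module A Q]

lemma LinearMap.ker_baseChange_of_flat [Module.Flat A B] (f : P →ₗ[A] Q) :
    LinearMap.ker (f.baseChange B) = (LinearMap.ker f).baseChange B :=
  Module.Flat.ker_lTensor_eq B B f

lemma Submodule.ker_baseChange_mkQ (N : Submodule A P) :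
    LinearMap.ker (N.mkQ.baseChange B) = N.baseChange B := by
  ext x
  exact SetLike.ext_iff.mp (lTensor_mkQ B N) x

/-- The intersection is the kernel of `N₁ → P / N₂`, and flat base change preserves kernels. -/
lemma Submodule.baseChange_inf_of_flat [Module.Flat A B] (N₁ N₂ : Submodule A P) :
    (N₁ ⊓ N₂).baseChange B = N₁.baseChange B ⊓ N₂.baseChange B := by
  refine le_antisymm (le_inf (Submodule.baseChange_mono B inf_le_left)
    (Submodule.baseChange_mono B inf_le_right)) ?_
  rintro x ⟨⟨y, rfl⟩, h⟩
  rw [← Submodule.ker_baseChange_mkQ] at h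
  have hy : y ∈ LinearMap.ker ((N₂.mkQ ∘ₗ N₁.subtype).baseChange B) := by
    rw [LinearMap.mem_ker, LinearMap.baseChange_comp]; exact h
  rw [LinearMap.ker_baseChange_of_flat] at hy
  obtain ⟨z, rfl⟩ := hy
  have e : N₁.subtype ∘ₗ (LinearMap.ker (N₂.mkQ ∘ₗ N₁.subtype)).subtype =
      (N₁ ⊓ N₂).subtype ∘ₗ LinearMap.codRestrict _
        (N₁.subtype ∘ₗ (LinearMap.ker (N₂.mkQ ∘ₗ N₁.subtype)).subtype)
        (fun c => ⟨c.1.2, (Submodule.Quotient.mk_eq_zero _).mp c.2⟩) := rfl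
  rw [← LinearMap.comp_apply, ← LinearMap.baseChange_comp, e, LinearMap.baseChange_comp]
  exact ⟨_, rfl⟩

/-- The colon by `x` is the kernel of `A → P / N`, `a ↦ a x`, so flatness applies again. -/
lemma Submodule.tmul_mem_baseChange_iff_colon [Module.Flat A B] (N : Submodule A P) (x : P)
    (b : B) :
    b ⊗ₜ x ∈ N.baseChange B ↔ b ⊗ₜ (1 : A) ∈ Submodule.baseChange B (N.colon {x}) := by
  have : N.colon {x} = LinearMap.ker (N.mkQ ∘ₗ LinearMap.toSpanSingleton A P x) := by
    ext a
    rw [Submodule.mem_colon_singleton, ← Submodule.Quotient.mk_eq_zero N]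
    rfl
  rw [this, ← LinearMap.ker_baseChange_of_flat, ← Submodule.ker_baseChange_mkQ]
  simp
end

namespace IsBaseChangeAlong
open scoped TensorProduct

variable {A B : Type*} [CommRing A] [CommRing B] {g : A →+* B}
    {P T : Type*} [AddCommGroup P] [Module A P] [AddCommGroup T] [Module B T]
    {ψ : P →ₛₗ[g] T}

lemma exists_equiv (h : IsBaseChangeAlong g ψ) :
    letI := g.toAlgebra
    ∃ e : TensorProduct A B P ≃ₗ[B] T, ∀ b x, e (b ⊗ₜ x) = b • ψ x := by
  let := g.toAlgebra
  let := Module.compHom T g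
  have : IsScalarTower A B T := ⟨fun a b t => by
    rw [Algebra.smul_def, mul_smul]; rfl⟩
  exact ⟨IsBaseChange.equiv h, fun b x => IsBaseChange.equiv_tmul h b x⟩

lemma exists_span_eq_map (h : IsBaseChangeAlong g ψ) :
    letI := g.toAlgebra
    ∃ e : TensorProduct A B P ≃ₗ[B] T, (∀ b x, e (b ⊗ₜ x) = b • ψ x) ∧ ∀ N : Submodule A P,
      Submodule.span B (ψ '' (N : Set P)) = (N.baseChange B).map e.toLinearMap := by
  let := g.toAlgebra
  obtain ⟨e, he⟩ := h.exists_equiv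
  refine ⟨e, he, fun N => ?_⟩
  rw [Submodule.baseChange_eq_span, Submodule.map_span]
  congr 1
  ext t
  simp [he]

lemma span_image_top (h : IsBaseChangeAlong g ψ) :
    Submodule.span B (ψ '' (⊤ : Submodule A P)) = ⊤ := by
  let := g.toAlgebra
  obtain ⟨e, -, he⟩ := h.exists_span_eq_map
  rw [he, Submodule.baseChange_top, Submodule.map_top, LinearEquiv.range]

lemma span_image_inf (h : IsBaseChangeAlong g ψ) (hg : g.Flat) (N₁ N₂ : Submodule A P) :
    Submodule.span B (ψ '' (N₁ ⊓ N₂ : Submodule A P)) =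
      Submodule.span B (ψ '' N₁) ⊓ Submodule.span B (ψ '' N₂) := by
  algebraize [g]
  obtain ⟨e, -, he⟩ := h.exists_span_eq_map
  rw [he, he, he, Submodule.baseChange_inf_of_flat, Submodule.map_inf _ e.injective]

lemma _root_.isBaseChangeAlong_self (g : A →+* B) : IsBaseChangeAlong g g.toSemilinearMap := by
  let := g.toAlgebra
  refine IsBaseChange.of_equiv (TensorProduct.AlgebraTensorModule.rid A B B) fun x => ?_
  simp [RingHom.toSemilinearMap, Algebra.smul_def]
  rfl

lemma _root_.Ideal.map_inf_of_flat (hg : g.Flat) (I J : Ideal A) :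
    (I ⊓ J).map g = I.map g ⊓ J.map g :=
  (isBaseChangeAlong_self g).span_image_inf hg I J

lemma map_colon_singleton (h : IsBaseChangeAlong g ψ) (hg : g.Flat) (N : Submodule A P) (x : P) :
    (N.colon {x}).map g = (Submodule.span B (ψ '' N)).colon {ψ x} := by
  algebraize [g]
  obtain ⟨e, he', he⟩ := h.exists_span_eq_map
  obtain ⟨e2, he2', he2⟩ := (isBaseChangeAlong_self g).exists_span_eq_map
  ext b
  have h1 := Submodule.tmul_mem_baseChange_iff_colon (B := B) N x b
  have h2 : b = e2 (b ⊗ₜ 1) := by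
    rw [he2']
    exact ((congrArg (b * ·) (map_one g)).trans (mul_one b)).symm
  have h3 : b ∈ (N.colon {x}).map g ↔ b ⊗ₜ (1 : A) ∈ Submodule.baseChange B (N.colon {x}) := by
    change b ∈ Submodule.span B (g.toSemilinearMap '' _) ↔ _
    rw [he2]
    conv_lhs => rw [h2]
    exact e2.injective.mem_set_image
  rw [h3, ← h1, Submodule.mem_colon_singleton, ← he', he]
  exact e.injective.mem_set_image.symm

/-- Finite generation turns the colon into a finite intersection of colons by single generators. -/
lemma map_colon_univ (h : IsBaseChangeAlong g ψ) (hg : g.Flat) [Module.Finite A P]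
    (N : Submodule A P) :
    (N.colon Set.univ).map g = (Submodule.span B (ψ '' N)).colon Set.univ := by
  classical
  obtain ⟨s, hs⟩ := Module.Finite.fg_top (R := A) (M := P)
  have h1 : (Set.univ : Set P) = (Submodule.span A (s : Set P) : Submodule A P) := by rw [hs]; rfl
  have h2 : (Set.univ : Set T) = (Submodule.span B (ψ '' s) : Submodule B T) := by
    have : Submodule.span B (ψ '' s) = ⊤ := by
      rw [← h.span_image_top, ← hs]
      refine le_antisymm (Submodule.span_mono (Set.image_mono Submodule.subset_span)) ?_
      rw [Submodule.span_le]
      rintro _ ⟨x, hx, rfl⟩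
      have : Submodule.span A (s : Set P) ≤ (Submodule.span B (ψ '' s)).comap ψ :=
        Submodule.span_le.mpr fun y hy => Submodule.subset_span ⟨y, hy, rfl⟩
      exact this hx
    rw [this]; rfl
  rw [h1, h2, Submodule.colon_span, Submodule.colon_span]
  clear h1 h2 hs
  induction s using Finset.induction_on with
  | empty => simp [Ideal.map_top]
  | insert a s _ ih =>
    rw [Finset.coe_insert, Set.image_insert_eq, Set.insert_eq, Set.insert_eq, Submodule.colon_union,
      Submodule.colon_union, Ideal.map_inf_of_flat hg, ih, h.map_colon_singleton hg]

end IsBaseChangeAlong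

lemma span_image_smul {A B : Type*} [CommRing A] [CommRing B] {g : A →+* B}
    {P T : Type*} [AddCommGroup P] [Module A P] [AddCommGroup T] [Module B T]
    (ψ : P →ₛₗ[g] T) (I : Ideal A) (N : Submodule A P) :
    Submodule.span B (ψ '' (I • N : Submodule A P)) = I.map g • Submodule.span B (ψ '' N) := by
  refine le_antisymm ?_ ?_
  · rw [Submodule.span_le]
    rintro _ ⟨x, hx, rfl⟩
    refine Submodule.smul_induction_on hx (fun a ha y hy => ?_) (fun y z hy hz => ?_)
    · rw [map_smulₛₗ]
      exact Submodule.smul_mem_smul (Ideal.mem_map_of_mem _ ha) (Submodule.subset_span ⟨y, hy, rfl⟩)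
    · rw [map_add]; exact add_mem hy hz
  · rw [Ideal.map, Submodule.span_smul_span]
    refine Submodule.span_mono ?_
    rintro _ ⟨_, ⟨a, ha, rfl⟩, _, ⟨x, hx, rfl⟩, rfl⟩
    exact ⟨a • x, Submodule.smul_mem_smul ha hx, map_smulₛₗ _ _ _⟩

/-! ### Extension of ideal sheaves on affine opens -/

namespace AlgebraicGeometry.Scheme.IdealSheafData

variable {Y Z : Scheme.{u}}

/-- Both sides are left adjoint to contraction, so they have the same upper bounds among ideals. -/
lemma ideal_comap_of_isAffine [IsAffine Y] [IsAffine Z] (f : Z ⟶ Y) (I : Y.IdealSheafData) :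
    (I.comap f).ideal ⟨⊤, isAffineOpen_top Z⟩ =
      (I.ideal ⟨⊤, isAffineOpen_top Y⟩).map f.appTop.hom := by
  refine eq_of_forall_ge_iff fun J => ?_
  obtain ⟨J, rfl⟩ : ∃ J' : Z.IdealSheafData, J'.ideal ⟨⊤, isAffineOpen_top Z⟩ = J :=
    equivOfIsAffine.surjective J
  rw [Ideal.map_le_iff_le_comap]
  have h : (J.map f).ideal ⟨⊤, isAffineOpen_top Y⟩ =
      (J.ideal ⟨⊤, isAffineOpen_top Z⟩).comap f.appTop.hom :=
    ideal_map J f ⟨⊤, isAffineOpen_top Y⟩ (isAffineOpen_top Z)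
  rw [← h]
  constructor
  · intro H
    exact le_map_iff_comap_le.mpr (le_of_isAffine H) _
  · intro H
    exact le_map_iff_comap_le.mp (le_of_isAffine H) _

lemma ideal_comap_of_isOpenImmersion_appLE (I : Y.IdealSheafData) (f : Z ⟶ Y) [IsOpenImmersion f]
    (U : Y.affineOpens) (V : Z.affineOpens) (e : V.1 ≤ f ⁻¹ᵁ U.1) :
    (I.comap f).ideal V = (I.ideal U).map (f.appLE U V e).hom := by
  have h : f ''ᵁ V.1 ≤ U.1 := (f.image_mono e).trans (f.image_preimage_le _)
  rw [ideal_comap_of_isOpenImmersion,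
    ← I.map_ideal (U := ⟨f ''ᵁ V, V.2.image_of_isOpenImmersion f⟩) (V := U) h]
  refine (Ideal.comap_symm (f.appIso V).commRingCatIsoToRingEquiv).trans ?_
  refine (Ideal.map_map _ _).trans ?_
  have : Y.presheaf.map (homOfLE h).op ≫ (f.appIso V).hom = f.appLE U V e := by
    rw [Scheme.Hom.appIso_hom', Scheme.Hom.map_appLE]
  rw [← this]
  rfl

lemma ideal_comap (I : Y.IdealSheafData) (f : Z ⟶ Y)
    (U : Y.affineOpens) (V : Z.affineOpens) (e : V.1 ≤ f ⁻¹ᵁ U.1) :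
    (I.comap f).ideal V = (I.ideal U).map (f.appLE U V e).hom := by
  obtain ⟨U, hU⟩ := U
  obtain ⟨V, hV⟩ := V
  change IsAffineOpen U at hU
  change IsAffineOpen V at hV
  change V ≤ f ⁻¹ᵁ U at e
  have w := IsAffineOpen.SpecMap_appLE_fromSpec f hU hV e
  have hu : (⊤ : (Spec Γ(Y, U)).Opens) ≤ hU.fromSpec ⁻¹ᵁ U := hU.fromSpec_preimage_self.ge
  have hv : (⊤ : (Spec Γ(Z, V)).Opens) ≤ hV.fromSpec ⁻¹ᵁ V := hV.fromSpec_preimage_self.ge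
  have h1 : ((I.comap f).comap hV.fromSpec).ideal ⟨⊤, isAffineOpen_top _⟩ =
     ((I.comap hU.fromSpec).comap (Spec.map (f.appLE U V e))).ideal ⟨⊤, isAffineOpen_top _⟩ := by
    rw [← comap_comp, ← comap_comp, w]
  have h2 := ideal_comap_of_isOpenImmersion_appLE (I.comap f) hV.fromSpec ⟨V, hV⟩
    ⟨⊤, isAffineOpen_top _⟩ hv
  have h3 := ideal_comap_of_isOpenImmersion_appLE I hU.fromSpec ⟨U, hU⟩ ⟨⊤, isAffineOpen_top _⟩ hu
  have h4 := ideal_comap_of_isAffine (Spec.map (f.appLE U V e)) (I.comap hU.fromSpec)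
  have h5 : hU.fromSpec.appLE U ⊤ hu ≫ (Spec.map (f.appLE U V e)).appTop =
      f.appLE U V e ≫ hV.fromSpec.appLE V ⊤ hv := by
    have : (Spec.map (f.appLE U V e)).appTop = (Spec.map (f.appLE U V e)).appLE ⊤ ⊤ le_top :=
      Scheme.Hom.app_eq_appLE _
    refine (congrArg (hU.fromSpec.appLE U ⊤ hu ≫ ·) this).trans
      ((Scheme.Hom.appLE_comp_appLE _ _ U ⊤ ⊤ hu le_top).trans ?_)
    rw [Scheme.Hom.appLE_comp_appLE]
    simp only [w]
  -- The chart induces an isomorphism on coordinate rings, so ideals may be compared after extension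
  -- to the spectrum.
  have h6 : IsIso (hV.fromSpec.appLE V ⊤ hv) := by
    rw [Scheme.Hom.appLE, IsAffineOpen.fromSpec_app_self,
      show homOfLE hv = eqToHom hV.fromSpec_preimage_self.symm from rfl]
    infer_instance
  have h7 : Function.Bijective (hV.fromSpec.appLE V ⊤ hv).hom :=
    ConcreteCategory.bijective_of_isIso (hV.fromSpec.appLE V ⊤ hv)
  rw [h1, h4, h3, Ideal.map_map, ← CommRingCat.hom_comp, h5, CommRingCat.hom_comp,
    ← Ideal.map_map] at h2
  have := congrArg (Ideal.comap (hV.fromSpec.appLE V ⊤ hv).hom) h2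
  rw [Ideal.comap_map_of_bijective _ h7, Ideal.comap_map_of_bijective _ h7] at this
  exact this.symm

end AlgebraicGeometry.Scheme.IdealSheafData

/-! ### Restriction to smaller affine opens -/

lemma IsBaseChangeAlong.congr {A B : Type*} [CommRing A] [CommRing B] {g g' : A →+* B}
    {P T : Type*} [AddCommGroup P] [Module A P] [AddCommGroup T] [Module B T]
    (hg : g = g') {ψ : P →ₛₗ[g] T} (h : IsBaseChangeAlong g ψ) (ψ' : P →ₛₗ[g'] T)
    (H : ∀ x, ψ' x = ψ x) : IsBaseChangeAlong g' ψ' := by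
  subst hg
  obtain rfl : ψ' = ψ := LinearMap.ext H
  exact h

namespace AlgebraicGeometry
open Scheme.Modules
variable {Y Z : Scheme.{u}}

lemma appLE_id {U V : Y.Opens} (e : V ≤ U) :
    (𝟙 Y :).appLE U V e = Y.presheaf.map (homOfLE e).op :=
  Category.id_comp _

lemma flat_presheafMap {U V : Y.Opens} (hU : IsAffineOpen U) (hV : IsAffineOpen V) (e : V ≤ U) :
    (Y.presheaf.map (homOfLE e).op).hom.Flat := by
  have := Scheme.Hom.flat_appLE (𝟙 Y) hU hV e
  rwa [appLE_id] at this

/-- Restriction of sections as a semilinear map. -/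
noncomputable def Scheme.Modules.restrictMap (M : Y.Modules) {U V : Y.Opens} (e : V ≤ U) :
    Γ(M, U) →ₛₗ[(Y.presheaf.map (homOfLE e).op).hom] Γ(M, V) where
  toFun x := M.presheaf.map (homOfLE e).op x
  map_add' := map_add _
  map_smul' a x := Scheme.Modules.map_smul M (homOfLE e) a x

/-- Pullback along the identity is the identity functor. -/
noncomputable def pullbackIdIso : pullback (𝟙 Y) ≅ 𝟭 _ :=
  ((pullbackPushforwardAdjunction (𝟙 Y)).ofNatIsoRight (pushforwardId Y)).leftAdjointUniq Adjunction.id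

lemma pullbackIdIso_apply (M : Y.Modules) (U : Y.Opens) (x : Γ(M, U)) :
    (pullbackIdIso.hom.app M).app U (((pullbackPushforwardAdjunction (𝟙 Y)).unit.app M).app U x) = x := by
  have := ((pullbackPushforwardAdjunction (𝟙 Y)).ofNatIsoRight
    (pushforwardId Y)).unit_leftAdjointUniq_hom_app Adjunction.id M
  have := congr(($this).app U x)
  simp at this
  exact this

/-- The linear equivalence on sections induced by an isomorphism of modules. -/
noncomputable def Scheme.Modules.appEquiv {M N : Y.Modules} (e : M ≅ N) (U : Y.Opens) :
    Γ(M, U) ≃ₗ[Γ(Y, U)] Γ(N, U) where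
  toFun x := e.hom.app U x
  invFun x := e.inv.app U x
  map_add' := map_add _
  map_smul' a x := Hom.app_smul _ a x
  left_inv x := congr(($(e.hom_inv_id)).app U x)
  right_inv x := congr(($(e.inv_hom_id)).app U x)

/-- Restriction is pullback along the identity, so the statement for pullbacks specializes. -/
theorem isBaseChangeAlong_restrictMap (M : Y.Modules) [M.IsQuasicoherent] {U V : Y.Opens}
    (hU : IsAffineOpen U) (hV : IsAffineOpen V) (e : V ≤ U) :
    IsBaseChangeAlong _ (M.restrictMap e) := by
  have hg : ((𝟙 Y :).appLE U V e).hom = (Y.presheaf.map (homOfLE e).op).hom := by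
    rw [appLE_id]
  let ψ : Γ(M, U) →ₛₗ[((𝟙 Y :).appLE U V e).hom] Γ(M, V) :=
   { toFun := M.restrictMap e
     map_add' := map_add _
     map_smul' := fun a x => by rw [hg]; exact (M.restrictMap e).map_smul' a x }
  refine IsBaseChangeAlong.congr hg (ψ := ψ) ?_ _ fun x => rfl
  refine (isBaseChangeAlong_pullbackMap (𝟙 Y) M hU hV e).of_equiv _ (LinearEquiv.refl _ _)
    (appEquiv (pullbackIdIso.app M) V) fun x => ?_
  have h1 : (pullbackIdIso.hom.app M).app V (((pullback (𝟙 Y)).obj M).presheaf.map (homOfLE e).op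
    (((pullbackPushforwardAdjunction (𝟙 Y)).unit.app M).app U x)) = _ :=
    congr($((pullbackIdIso.hom.app M).mapPresheaf.naturality (homOfLE e).op) _)
  refine Eq.trans ?_ h1.symm
  exact congrArg (M.presheaf.map (homOfLE e).op) (pullbackIdIso_apply M U x).symm

end AlgebraicGeometry

/-! ### The shear isomorphism and flatness of the action -/

namespace GPrimary
open AlgebraicGeometry.Scheme.Modules

section shear
variable {C : Type*} [Category C] [CartesianMonoidalCategory C] (G X : C) [GrpObj G] [ModObj G X]

/-- The shear isomorphism `(g, x) ↦ (g, g x)`. -/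
noncomputable def shear : G ⊗ X ≅ G ⊗ X where
  hom := lift (fst G X) (fst G X • snd G X)
  inv := lift (fst G X) ((fst G X)⁻¹ • snd G X)
  hom_inv_id := by
    rw [comp_lift, ModObj.comp_smul, GrpObj.comp_inv]
    simp
  inv_hom_id := by
    rw [comp_lift, ModObj.comp_smul]
    simp

lemma shear_snd : (shear G X).hom ≫ snd G X = γ[G, X] := by
  simp [shear, Hom.smul_def]
end shear

variable {S : Scheme.{u}} (G X : Over S) [GrpObj G] [ModObj G X]

lemma flat_act [Flat (proj G X)] : Flat (act G X) := by
  have h : act G X = (shear G X).hom.left ≫ proj G X := by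
    rw [← Over.comp_left, shear_snd]
  have : IsIso (shear G X).hom.left := inferInstanceAs (IsIso ((Over.forget S).map (shear G X).hom))
  rw [h]
  infer_instance

end GPrimary

/-! ### Operations on quasi-coherent submodules and their equivariance -/

namespace GPrimary
open AlgebraicGeometry.Scheme.Modules

namespace QCohSubmodule
variable {Y : Scheme.{u}} {M : Y.Modules}

lemma isBaseChangeAlong_basicOpen [M.IsQuasicoherent] (U : Y.affineOpens) (f : Γ(Y, U)) :
    IsBaseChangeAlong _ (M.restrictMap (Y.basicOpen_le f)) :=
  isBaseChangeAlong_restrictMap M U.2 (Y.affineBasicOpen f).2 (Y.basicOpen_le f)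

lemma flat_basicOpen (U : Y.affineOpens) (f : Γ(Y, U)) :
    (Y.presheaf.map (homOfLE (Y.basicOpen_le f)).op).hom.Flat :=
  flat_presheafMap U.2 (Y.affineBasicOpen f).2 _

noncomputable instance [M.IsQuasicoherent] : OrderTop (QCohSubmodule M) where
  top :=
    { sections := ⊤
      span_basicOpen := fun U f => (isBaseChangeAlong_basicOpen U f).span_image_top }
  le_top _ _ := le_top

noncomputable instance [M.IsQuasicoherent] : SemilatticeInf (QCohSubmodule M) where
  inf N₁ N₂ :=
    { sections := N₁.sections ⊓ N₂.sections
      span_basicOpen := fun U f =>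
        ((isBaseChangeAlong_basicOpen U f).span_image_inf (flat_basicOpen U f) _ _).trans
          (congrArg₂ (· ⊓ ·) (N₁.span_basicOpen U f) (N₂.span_basicOpen U f)) }
  inf_le_left _ _ _ := inf_le_left
  inf_le_right _ _ _ := inf_le_right
  le_inf _ _ _ h₁ h₂ U := le_inf (h₁ U) (h₂ U)

/-- The submodule `I N` for an ideal sheaf `I`. -/
noncomputable instance : SMul Y.IdealSheafData (QCohSubmodule M) where
  smul I N :=
    { sections := fun U => I.ideal U • N.sections U
      span_basicOpen := fun U f =>
        (span_image_smul (M.restrictMap (Y.basicOpen_le f)) _ _).trans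
          (congrArg₂ (· • ·) (I.map_ideal_basicOpen U f) (N.span_basicOpen U f)) }

@[simp] lemma sections_top [M.IsQuasicoherent] : (⊤ : QCohSubmodule M).sections = ⊤ := rfl

@[simp] lemma sections_inf [M.IsQuasicoherent] (N₁ N₂ : QCohSubmodule M) :
    (N₁ ⊓ N₂).sections = N₁.sections ⊓ N₂.sections := rfl

/-- For coherent `M` the affine colons already commute with localization, so passing to the largest
ideal sheaf below them changes nothing. -/
lemma ideal_colon (hM : IsCoherent M) (N : QCohSubmodule M) (U : Y.affineOpens) :
    N.colon.ideal U = (N.sections U).colon Set.univ := by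
  have := hM.isQuasicoherent
  let I : Y.IdealSheafData :=
    { ideal := fun U => (N.sections U).colon Set.univ
      map_ideal_basicOpen := fun U f => by
        have := hM.finite_sections U
        refine ((isBaseChangeAlong_basicOpen U f).map_colon_univ (flat_basicOpen U f) _).trans ?_
        exact congrArg (fun L => Submodule.colon L Set.univ) (N.span_basicOpen U f) }
  exact congr(($(Scheme.IdealSheafData.ofIdeals_ideal I)).ideal U)

lemma colon_smul_le (N L : QCohSubmodule M) : N.colon • L ≤ N := by
  intro U
  refine Submodule.smul_le.mpr fun a ha x _ => ?_
  exact Submodule.mem_colon.mp (Scheme.IdealSheafData.ideal_ofIdeals_le _ U ha) x trivial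

lemma smul_le (I : Y.IdealSheafData) (L : QCohSubmodule M) : I • L ≤ L :=
  fun _ => Submodule.smul_le_right

lemma smul_mono {I J : Y.IdealSheafData} {L L' : QCohSubmodule M} (h : I ≤ J) (h' : L ≤ L') :
    I • L ≤ J • L' :=
  fun U => Submodule.smul_mono (h U) (h' U)

lemma mul_smul (I J : Y.IdealSheafData) (L : QCohSubmodule M) : (I * J) • L = I • J • L := by
  ext U : 2
  exact Submodule.mul_smul _ _ _

section pullback
variable {Z : Scheme.{u}} (f : Z ⟶ Y) {U : Y.affineOpens} {V : Z.affineOpens} (hV : V.1 ≤ f ⁻¹ᵁ U.1)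

lemma pullbackSections_top [M.IsQuasicoherent] :
    (⊤ : QCohSubmodule M).pullbackSections f U V hV = ⊤ :=
  (isBaseChangeAlong_pullbackMap f M U.2 V.2 hV).span_image_top

lemma pullbackSections_inf [M.IsQuasicoherent] [Flat f] (N₁ N₂ : QCohSubmodule M) :
    (N₁ ⊓ N₂).pullbackSections f U V hV =
      N₁.pullbackSections f U V hV ⊓ N₂.pullbackSections f U V hV :=
  (isBaseChangeAlong_pullbackMap f M U.2 V.2 hV).span_image_inf (f.flat_appLE U.2 V.2 hV) _ _

lemma pullbackSections_smul (I : Y.IdealSheafData) (N : QCohSubmodule M) :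
    (I • N).pullbackSections f U V hV = (I.comap f).ideal V • N.pullbackSections f U V hV :=
  (span_image_smul (pullbackMap f M U V hV) _ _).trans
    (congrArg (· • _) (I.ideal_comap f U V hV).symm)

lemma ideal_comap_colon (hM : IsCoherent M) [Flat f] (N : QCohSubmodule M) :
    (N.colon.comap f).ideal V = (N.pullbackSections f U V hV).colon Set.univ := by
  have := hM.isQuasicoherent
  have := hM.finite_sections U
  rw [N.colon.ideal_comap f U V hV, ideal_colon hM]
  exact (isBaseChangeAlong_pullbackMap f M U.2 V.2 hV).map_colon_univ (f.flat_appLE U.2 V.2 hV) _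

end pullback
end QCohSubmodule

variable {S : Scheme.{u}} {G X : Over S} [GrpObj G] [ModObj G X] {M : X.left.Modules}
  {Φ : Linearization G X M}

open QCohSubmodule

lemma isGSubmodule_iff {N : QCohSubmodule M} : IsGSubmodule Φ N ↔
    ∀ (U U' : X.left.affineOpens) (V : (G ⊗ X).left.affineOpens)
    (hU : V.1 ≤ act G X ⁻¹ᵁ U.1) (hU' : V.1 ≤ proj G X ⁻¹ᵁ U'.1),
    (N.pullbackSections (act G X) U V hU).map (appEquiv Φ.iso V.1).toLinearMap =
      N.pullbackSections (proj G X) U' V hU' := by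
  simp only [IsGSubmodule, ← SetLike.coe_set_eq, Submodule.map_coe]
  rfl

lemma isGSubmodule_top [M.IsQuasicoherent] : IsGSubmodule Φ ⊤ := by
  rw [isGSubmodule_iff]
  intro U U' V hU hU'
  rw [pullbackSections_top, pullbackSections_top, Submodule.map_top, LinearEquiv.range]

lemma IsGSubmodule.inf [M.IsQuasicoherent] [Flat (proj G X)] {N₁ N₂ : QCohSubmodule M}
    (h₁ : IsGSubmodule Φ N₁) (h₂ : IsGSubmodule Φ N₂) : IsGSubmodule Φ (N₁ ⊓ N₂) := by
  have := flat_act G X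
  rw [isGSubmodule_iff] at *
  intro U U' V hU hU'
  rw [pullbackSections_inf, pullbackSections_inf, Submodule.map_inf _ (appEquiv Φ.iso V.1).injective,
    h₁ _ U' _ _ hU', h₂ _ U' _ _ hU']

lemma IsGSubmodule.smul {I : X.left.IdealSheafData} {N : QCohSubmodule M}
    (hI : IsGIdeal G X I) (h : IsGSubmodule Φ N) : IsGSubmodule Φ (I • N) := by
  rw [isGSubmodule_iff] at *
  intro U U' V hU hU'
  rw [pullbackSections_smul, pullbackSections_smul, Submodule.map_smul'', h _ U' _ _ hU', hI]

lemma isGIdeal_colon (hM : IsCoherent M) [Flat (proj G X)] {N : QCohSubmodule M}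
    (h : IsGSubmodule Φ N) : IsGIdeal G X N.colon := by
  have := flat_act G X
  rw [isGSubmodule_iff] at h
  -- The affine opens on which equivariance is tested cover `G × X`, so equality of ideals can be
  -- checked on them.
  have key : ∀ z : (G ⊗ X).left, ∃ (V : (G ⊗ X).left.affineOpens), z ∈ V.1 ∧
      ∃ (U U' : X.left.affineOpens), V.1 ≤ act G X ⁻¹ᵁ U.1 ∧ V.1 ≤ proj G X ⁻¹ᵁ U'.1 := by
    intro z
    obtain ⟨_, ⟨U, hU, rfl⟩, hz, -⟩ := X.left.isBasis_affineOpens.exists_subset_of_mem_open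
      (Set.mem_univ (act G X z)) isOpen_univ
    obtain ⟨_, ⟨U', hU', rfl⟩, hz', -⟩ := X.left.isBasis_affineOpens.exists_subset_of_mem_open
      (Set.mem_univ (proj G X z)) isOpen_univ
    obtain ⟨_, ⟨V, hV, rfl⟩, hzV, hVW⟩ := (G ⊗ X).left.isBasis_affineOpens.exists_subset_of_mem_open
      (show z ∈ ((act G X ⁻¹ᵁ U ⊓ proj G X ⁻¹ᵁ U' : (G ⊗ X).left.Opens) : Set _) from ⟨hz, hz'⟩)
      (act G X ⁻¹ᵁ U ⊓ proj G X ⁻¹ᵁ U').isOpen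
    exact ⟨⟨V, hV⟩, hzV, ⟨U, hU⟩, ⟨U', hU'⟩, fun _ h => (hVW h).1, fun _ h => (hVW h).2⟩
  choose V hzV U U' hU hU' using key
  refine Scheme.IdealSheafData.ext_of_iSup_eq_top V ?_ fun z => ?_
  · exact top_le_iff.mp fun z _ => TopologicalSpace.Opens.mem_iSup.mpr ⟨z, hzV z⟩
  · rw [ideal_comap_colon _ (hU z) hM, ideal_comap_colon _ (hU' z) hM, ← h _ _ _ (hU z) (hU' z)]
    ext b
    simp only [Submodule.mem_colon, Set.mem_univ, forall_const]
    refine (appEquiv Φ.iso (V z).1).toEquiv.forall_congr fun x => ?_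
    have := (appEquiv Φ.iso (V z).1).map_smul b x
    refine Iff.trans ?_ (iff_of_eq (congrArg (· ∈ _) this))
    exact (appEquiv Φ.iso (V z).1).injective.mem_set_image.symm

end GPrimary

/-! ### Products of primes on a noetherian scheme -/

namespace AlgebraicGeometry.Scheme.IdealSheafData

variable {Y : Scheme.{u}}

lemma isReduced_subscheme_vanishingIdeal (Z : TopologicalSpace.Closeds Y) :
    IsReduced (vanishingIdeal Z).subscheme := by
  have (U : (vanishingIdeal Z).subschemeCover.openCover.I₀) :
      IsReduced ((vanishingIdeal Z).subschemeCover.openCover.X U) := by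
    let U : Y.affineOpens := U
    have : _root_.IsReduced (Γ(Y, U) ⧸ (vanishingIdeal Z).ideal U) := by
      rw [← Ideal.isRadical_iff_quotient_reduced, vanishingIdeal_ideal]
      exact PrimeSpectrum.isRadical_vanishingIdeal _
    exact inferInstanceAs (IsReduced (Spec (.of (Γ(Y, U) ⧸ (vanishingIdeal Z).ideal U))))
  exact IsReduced.of_openCover _ (vanishingIdeal Z).subschemeCover.openCover

lemma isIntegral_subscheme_vanishingIdeal {Z : TopologicalSpace.Closeds Y}
    (hZ : IsIrreducible (Z : Set Y)) : IsIntegral (vanishingIdeal Z).subscheme := by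
  have := isReduced_subscheme_vanishingIdeal Z
  have : IrreducibleSpace (vanishingIdeal Z).subscheme :=
    Subtype.irreducibleSpace (s := ((vanishingIdeal Z).support : Set Y)) (by simpa using hZ)
  exact isIntegral_of_irreducibleSpace_of_isReduced _

lemma exists_radical_pow_le [IsNoetherian Y] (K : Y.IdealSheafData) :
    ∃ n : ℕ, K.radical ^ n ≤ K := by
  obtain ⟨s, hs, e⟩ := (isCompact_iff_finite_and_eq_biUnion_affineOpens (U := (⊤ : Y.Opens))).mp
    isCompact_univ
  have (U : Y.affineOpens) : ∃ n : ℕ, (K.ideal U).radical ^ n ≤ K.ideal U :=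
    have : IsNoetherianRing Γ(Y, U) := IsLocallyNoetherian.component_noetherian U
    Ideal.exists_radical_pow_le_of_fg _ (IsNoetherian.noetherian _)
  choose n hn using this
  -- The largest of the local exponents over a finite affine cover works everywhere.
  refine ⟨hs.toFinset.sup n, le_of_iSup_eq_top (fun U : s => U.1) ?_ fun U => ?_⟩
  · rw [e, iSup_subtype]
  · exact (Ideal.pow_le_pow_right (Finset.le_sup (by simp))).trans (hn U.1)

/-- On a noetherian scheme every ideal `K` contains a finite product of ideals of integral closed
subschemes that contain `K`. -/
lemma exists_list_prod_le [IsNoetherian Y] (K : Y.IdealSheafData) :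
    ∃ l : List Y.IdealSheafData, (∀ p ∈ l, IsIntegral p.subscheme ∧ K ≤ p) ∧ l.prod ≤ K := by
  obtain ⟨S, hS, hirr, hK⟩ :=
    TopologicalSpace.NoetherianSpace.exists_finite_set_closeds_irreducible K.support
  obtain ⟨n, hn⟩ := K.exists_radical_pow_le
  have hle : (hS.toFinset.toList.map vanishingIdeal).prod ≤ K.radical := by
    rw [← vanishingIdeal_support, hK, vanishingIdeal_sSup]
    refine le_iInf₂ fun Z hZ => ?_
    have hZ' : Z ∈ hS.toFinset.toList := by simpa using hZ
    generalize hS.toFinset.toList = l at hZ'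
    induction l with
    | nil => simp at hZ'
    | cons W l ih =>
      rw [List.map_cons, List.prod_cons]
      rcases List.mem_cons.mp hZ' with rfl | h
      · exact fun U => Ideal.mul_le_left
      · exact le_trans (fun U => Ideal.mul_le_right) (ih h)
  -- The ideals of the closed pieces of the support, each repeated `n` times: one round has product
  -- inside the radical, and its `n`th power lies in `K`.
  refine ⟨(List.replicate n (hS.toFinset.toList.map vanishingIdeal)).flatten, fun p hp => ?_, ?_⟩
  · obtain ⟨l, hl, hp⟩ := List.mem_flatten.mp hp
    rw [List.eq_of_mem_replicate hl] at hp
    obtain ⟨Z, hZ, rfl⟩ := List.mem_map.mp hp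
    have hZ : Z ∈ S := by simpa using hZ
    exact ⟨isIntegral_subscheme_vanishingIdeal (hirr Z hZ),
      le_support_iff_le_vanishingIdeal.mp (hK ▸ le_sSup hZ)⟩
  · rw [List.prod_flatten, List.map_replicate, List.prod_replicate]
    exact (pow_le_pow_left' hle n).trans hn

end AlgebraicGeometry.Scheme.IdealSheafData

/-! ### `G`-cores, `G`-radicals and `G`-primes -/

namespace GPrimary

variable {S : Scheme.{u}} (G X : Over S) [GrpObj G] [ModObj G X]

lemma gCore_le (I : X.left.IdealSheafData) : gCore G X I ≤ I :=
  sSup_le fun _ h => h.2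

variable {G X} in
lemma IsGIdeal.le_gCore {I J : X.left.IdealSheafData} (hJ : IsGIdeal G X J) (h : J ≤ I) :
    J ≤ gCore G X I :=
  le_sSup ⟨hJ, h⟩

/-- Extension of ideals is a left adjoint, so it commutes with sums of ideals. -/
lemma isGIdeal_gCore (I : X.left.IdealSheafData) : IsGIdeal G X (gCore G X I) := by
  rw [IsGIdeal, gCore, (Scheme.IdealSheafData.map_gc (act G X)).l_sSup,
    (Scheme.IdealSheafData.map_gc (proj G X)).l_sSup]
  exact biSup_congr fun J hJ => hJ.1

lemma isGPrime_gCore {p : X.left.IdealSheafData} (hp : IsIntegral p.subscheme) :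
    IsGPrime G X (gCore G X p) :=
  ⟨isGIdeal_gCore G X p, p, hp, rfl⟩

lemma gRadical_le {I P : X.left.IdealSheafData} (hP : IsGPrime G X P) (h : I ≤ P) :
    gRadical G X I ≤ P :=
  (gCore_le G X _).trans (sInf_le ⟨hP, h⟩)

variable {G X} {M : X.left.Modules} {Φ : Linearization G X M}

/-- Apply the factors to `L` successively; the one whose application first lands in `N` is the
required `I`. -/
lemma exists_gSubmodule_of_prod_smul_le (l : List X.left.IdealSheafData)
    (hl : ∀ I ∈ l, IsGIdeal G X I) {L N : QCohSubmodule M} (hL : IsGSubmodule Φ L)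
    (h : l.prod • L ≤ N) (hLN : ¬ L ≤ N) :
    ∃ I ∈ l, ∃ L' : QCohSubmodule M, IsGSubmodule Φ L' ∧ ¬ L' ≤ N ∧ I • L' ≤ N := by
  induction l generalizing L with
  | nil =>
    refine (hLN (le_trans (fun U => ?_) h)).elim
    exact (Submodule.top_smul _).ge
  | cons I l ih =>
    rw [List.forall_mem_cons] at hl
    by_cases h' : I • L ≤ N
    · exact ⟨I, List.mem_cons_self, L, hL, hLN, h'⟩
    · rw [List.prod_cons, mul_comm, QCohSubmodule.mul_smul] at h
      obtain ⟨J, hJ, H⟩ := ih hl.2 (hL.smul hl.1) h h'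
      exact ⟨J, List.mem_cons_of_mem _ hJ, H⟩

variable [Flat (proj G X)] [IsNoetherian X.left]

/-- The `G`-radical of `Q : M` is `G`-prime if `Q` is `G`-primary. -/
lemma IsGPrimary.isGPrime_gPrimeOf (hM : IsCoherent M) {Q : QCohSubmodule M}
    (hQ : IsGPrimary Φ Q) : IsGPrime G X (gPrimeOf G Q) := by
  have := hM.isQuasicoherent
  have hcolon := isGIdeal_colon hM hQ.isGSubmodule
  obtain ⟨l, hl, hprod⟩ := Q.colon.exists_list_prod_le
  have hprod' : (l.map (gCore G X)).prod ≤ Q.colon := by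
    refine le_trans ?_ hprod
    simpa using List.prod_map_le_prod_map₀ (s := l) (gCore G X) id
      (fun _ _ => bot_le) (fun _ _ => gCore_le G X _)
  obtain ⟨I, hI, L, hL, hLQ, hle⟩ := exists_gSubmodule_of_prod_smul_le (l.map (gCore G X))
    (by simpa using fun p _ => isGIdeal_gCore G X p) (isGSubmodule_top (Φ := Φ)) (N := Q)
    (le_trans (QCohSubmodule.smul_mono hprod' le_rfl) (Q.colon_smul_le ⊤))
    fun h => hQ.ne_top (top_le_iff.mp h)
  obtain ⟨p, hp, rfl⟩ := List.mem_map.mp hI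
  have hpr := isGPrime_gCore G X (hl p hp).1
  -- The core of `p` is a `G`-prime containing the colon, hence contains the radical; primariness
  -- gives the reverse inclusion.
  rwa [gPrimeOf, (gRadical_le G X hpr (hcolon.le_gCore (hl p hp).2)).antisymm
    (hQ.le_gRadical_colon L _ hL (isGIdeal_gCore G X p) hle hLQ)]

lemma IsGPrimary.gPrimeOf_le (hM : IsCoherent M) {Q Q' : QCohSubmodule M}
    (hQ' : IsGPrimary Φ Q') (h : Q.colon ≤ gPrimeOf G Q') : gPrimeOf G Q ≤ gPrimeOf G Q' :=
  gRadical_le G X (hQ'.isGPrime_gPrimeOf hM) h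

end GPrimary

/-! ### Comparison of two decompositions -/

namespace GPrimary

namespace QCohSubmodule

variable {Y : Scheme.{u}} {M : Y.Modules}

lemma sections_finset_inf [M.IsQuasicoherent] {κ : Type*} (s : Finset κ)
    (Q : κ → QCohSubmodule M) : (s.inf Q).sections = ⨅ i ∈ s, (Q i).sections := by
  rw [← Finset.inf_eq_iInf]
  exact Finset.apply_inf_eq_inf_comp sections sections_inf sections_top

lemma sections_univ_inf [M.IsQuasicoherent] {κ : Type*} [Fintype κ]
    (Q : κ → QCohSubmodule M) : (Finset.univ.inf Q).sections = ⨅ i, (Q i).sections := by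
  simp [sections_finset_inf]

end QCohSubmodule

open QCohSubmodule

variable {S : Scheme.{u}} {G X : Over S} [GrpObj G] [ModObj G X] {M : X.left.Modules}
  {Φ : Linearization G X M}

lemma IsGSubmodule.finset_inf [M.IsQuasicoherent] [Flat (proj G X)] {κ : Type*} {s : Finset κ}
    {Q : κ → QCohSubmodule M} (h : ∀ i ∈ s, IsGSubmodule Φ (Q i)) : IsGSubmodule Φ (s.inf Q) :=
  Finset.inf_induction isGSubmodule_top (fun _ h₁ _ h₂ => h₁.inf h₂) h

/-- Whenever `(Q a).colon • L'` is still not in `N`, it replaces `L'` and lies in `Q a`. Both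
alternatives pass to smaller submodules, so earlier choices survive. -/
lemma exists_le_forall_le_or_colon_smul_le [Flat (proj G X)] (hM : IsCoherent M) {κ : Type*}
    (s : Finset κ) {Q : κ → QCohSubmodule M} (hQ : ∀ i, IsGSubmodule Φ (Q i))
    {L N : QCohSubmodule M} (hL : IsGSubmodule Φ L) (hLN : ¬ L ≤ N) :
    ∃ L' ≤ L, IsGSubmodule Φ L' ∧ ¬ L' ≤ N ∧ ∀ i ∈ s, L' ≤ Q i ∨ (Q i).colon • L' ≤ N := by
  classical
  induction s using Finset.induction_on with
  | empty => exact ⟨L, le_rfl, hL, hLN, by simp⟩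
  | insert a s _ ih =>
    obtain ⟨L', hle, hL', hN, h⟩ := ih
    by_cases ha : (Q a).colon • L' ≤ N
    · exact ⟨L', hle, hL', hN, (Finset.forall_mem_insert _ _ _).mpr ⟨.inr ha, h⟩⟩
    · refine ⟨(Q a).colon • L', (smul_le _ _).trans hle, hL'.smul (isGIdeal_colon hM (hQ a)), ha,
        (Finset.forall_mem_insert _ _ _).mpr ⟨.inl (colon_smul_le _ _), fun i hi => ?_⟩⟩
      exact (h i hi).imp (smul_le _ _).trans (smul_mono le_rfl (smul_le _ _)).trans

variable [Flat (proj G X)] [AlgebraicGeometry.IsNoetherian X.left]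

lemma IsGPrimary.gPrimeOf_le_of_colon_smul_le (hM : IsCoherent M) {Q Q' L : QCohSubmodule M}
    (hQ : IsGSubmodule Φ Q) (hQ' : IsGPrimary Φ Q') (hL : IsGSubmodule Φ L) (hLQ' : ¬ L ≤ Q')
    (h : Q.colon • L ≤ Q') : gPrimeOf G Q ≤ gPrimeOf G Q' :=
  hQ'.gPrimeOf_le hM (hQ'.le_gRadical_colon L _ hL (isGIdeal_colon hM hQ) h hLQ')

/-- Components whose `G`-prime is not below that of `Q'` can be dropped one by one: `(Q a).colon •
L` lies in `L ⊓ Q a`, so `L ⊓ Q a ≤ Q'` without `L ≤ Q'` would force the excluded inclusion. -/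
lemma IsGPrimary.le_of_inf_finset_inf_le [M.IsQuasicoherent] (hM : IsCoherent M) {κ : Type*}
    {s : Finset κ} {Q : κ → QCohSubmodule M} {L Q' : QCohSubmodule M}
    (hQ : ∀ i, IsGSubmodule Φ (Q i)) (hQ' : IsGPrimary Φ Q') (hL : IsGSubmodule Φ L)
    (hs : ∀ i ∈ s, ¬ gPrimeOf G (Q i) ≤ gPrimeOf G Q') (h : L ⊓ s.inf Q ≤ Q') : L ≤ Q' := by
  classical
  induction s using Finset.induction_on generalizing L with
  | empty => simpa using h
  | insert a s _ ih =>
    rw [Finset.forall_mem_insert] at hs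
    rw [Finset.inf_insert, ← inf_assoc] at h
    have h := ih (hL.inf (hQ a)) hs.2 h
    by_contra hLQ'
    exact hs.1 (hQ'.gPrimeOf_le_of_colon_smul_le hM (hQ a) hL hLQ'
      ((le_inf (smul_le _ _) (colon_smul_le _ _)).trans h))

section decomposition

variable {N : QCohSubmodule M} {r s : ℕ} {Q : Fin r → QCohSubmodule M}
  {Q' : Fin s → QCohSubmodule M}

lemma range_gPrimeOf_subset (hM : IsCoherent M) (hQ : IsMinimalGPrimaryDecomposition Φ N Q)
    (hQ' : IsMinimalGPrimaryDecomposition Φ N Q') :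
    Set.range (fun i => gPrimeOf G (Q i)) ⊆ Set.range (fun j => gPrimeOf G (Q' j)) := by
  have := hM.isQuasicoherent
  rintro _ ⟨i, rfl⟩
  have hGQ i := (hQ.isGPrimary i).isGSubmodule
  have hGQ' j := (hQ'.isGPrimary j).isGSubmodule
  have hN : Finset.univ.inf Q = N := QCohSubmodule.ext ((sections_univ_inf Q).trans hQ.iInf_eq)
  have hN' : Finset.univ.inf Q' = N := QCohSubmodule.ext ((sections_univ_inf Q').trans hQ'.iInf_eq)
  have hinf : (Finset.univ.erase i).inf Q ⊓ Q i = N := by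
    rw [inf_comm, ← Finset.inf_insert, Finset.insert_erase (Finset.mem_univ i), hN]
  have hne : ¬ (Finset.univ.erase i).inf Q ≤ N := fun h => by
    refine hQ.irredundant i ?_
    rw [← h.antisymm (hinf ▸ inf_le_left), sections_finset_inf]
    simp
  -- Since `L` lies in all the other `Q k`, membership in `N` is the same as membership in `Q i`;
  -- this drives both inclusions below.
  obtain ⟨L, hL, hGL, hLN, h⟩ := exists_le_forall_le_or_colon_smul_le hM Finset.univ hGQ'
    (IsGSubmodule.finset_inf fun j _ => hGQ j) hne
  obtain ⟨j, hj⟩ : ∃ j, ¬ L ≤ Q' j := by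
    by_contra! hle
    exact hLN (hN' ▸ Finset.le_inf fun j _ => hle j)
  refine ⟨j, le_antisymm ?_ ?_⟩
  · refine (hQ.isGPrimary i).gPrimeOf_le_of_colon_smul_le hM (hGQ' j) hGL
      (fun hLi => hLN (hinf ▸ le_inf hL hLi)) ?_
    exact ((h j (Finset.mem_univ j)).resolve_left hj).trans (hinf ▸ inf_le_right)
  · refine (hQ'.isGPrimary j).gPrimeOf_le_of_colon_smul_le hM (hGQ i) hGL hj ?_
    refine (le_inf ((smul_le _ _).trans hL) (colon_smul_le _ _)).trans ?_
    exact hinf.trans_le (hN'.ge.trans (Finset.inf_le (Finset.mem_univ j)))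

lemma iInf_sections_le (hM : IsCoherent M) (hQ : IsMinimalGPrimaryDecomposition Φ N Q)
    (hQ' : IsMinimalGPrimaryDecomposition Φ N Q') {Ω : Set X.left.IdealSheafData}
    (hΩ : ∀ P ∈ Ω, ∀ P' ∈ Set.range (fun i => gPrimeOf G (Q i)), P' ≤ P → P' ∈ Ω) :
    ⨅ (i) (_ : gPrimeOf G (Q i) ∈ Ω), (Q i).sections ≤
      ⨅ (j) (_ : gPrimeOf G (Q' j) ∈ Ω), (Q' j).sections := by
  classical
  have := hM.isQuasicoherent
  have hGQ i := (hQ.isGPrimary i).isGSubmodule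
  have hN : Finset.univ.inf Q = N := QCohSubmodule.ext ((sections_univ_inf Q).trans hQ.iInf_eq)
  refine le_iInf₂ fun j hj => ?_
  have key : {i | gPrimeOf G (Q i) ∈ Ω}.toFinset.inf Q ≤ Q' j := by
    refine (hQ'.isGPrimary j).le_of_inf_finset_inf_le hM
      (s := {i | gPrimeOf G (Q i) ∉ Ω}.toFinset) hGQ
      (IsGSubmodule.finset_inf fun i _ => hGQ i)
      (fun i hi hle => Set.mem_toFinset.mp hi (hΩ _ hj _ ⟨i, rfl⟩ hle)) ?_
    rw [← Finset.inf_union]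
    -- The indices inside and outside `Ω` together exhaust the decomposition of `N`.
    refine le_trans (b := N) (hN ▸ Finset.inf_mono fun i _ => ?_) ?_
    · simpa using em _
    · exact hQ'.iInf_eq.symm.trans_le (iInf_le _ j)
  refine le_trans (le_of_eq ?_) key
  rw [sections_finset_inf]
  simp

end decomposition

end GPrimary

open CategoryTheory MonoidalCategory CartesianMonoidalCategory AlgebraicGeometry GPrimary in
theorem mainTheorem3 {S : Scheme.{u}} (G X : Over S) [GrpObj G] [ModObj G X]
    [Flat (proj G X)] [AlgebraicGeometry.IsNoetherian X.left]
    (M : X.left.Modules) (hM : IsCoherent M) (Φ : Linearization G X M)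
    (N : QCohSubmodule M) (hN : IsGSubmodule Φ N)
    {r s : ℕ} (Q : Fin r → QCohSubmodule M) (Q' : Fin s → QCohSubmodule M)
    (hQ : IsMinimalGPrimaryDecomposition Φ N Q)
    (hQ' : IsMinimalGPrimaryDecomposition Φ N Q') :
    Set.range (fun i => gPrimeOf G (Q i)) = Set.range (fun j => gPrimeOf G (Q' j)) ∧
    (∀ Ω ⊆ Set.range (fun i => gPrimeOf G (Q i)),
      (∀ P ∈ Ω, ∀ P' ∈ Set.range (fun i => gPrimeOf G (Q i)), P' ≤ P → P' ∈ Ω) →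
      ⨅ (i) (_ : gPrimeOf G (Q i) ∈ Ω), (Q i).sections =
        ⨅ (j) (_ : gPrimeOf G (Q' j) ∈ Ω), (Q' j).sections) ∧
    (∀ i, Minimal (fun P => P ∈ Set.range (fun i => gPrimeOf G (Q i))) (gPrimeOf G (Q i)) →
      ∃ j, gPrimeOf G (Q' j) = gPrimeOf G (Q i) ∧ Q' j = Q i) := by
  have hrange : Set.range (fun i => gPrimeOf G (Q i)) = Set.range (fun j => gPrimeOf G (Q' j)) :=
    (range_gPrimeOf_subset hM hQ hQ').antisymm (range_gPrimeOf_subset hM hQ' hQ)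
  have hinf (Ω : Set X.left.IdealSheafData)
      (hΩ : ∀ P ∈ Ω, ∀ P' ∈ Set.range (fun i => gPrimeOf G (Q i)), P' ≤ P → P' ∈ Ω) :
      ⨅ (i) (_ : gPrimeOf G (Q i) ∈ Ω), (Q i).sections =
        ⨅ (j) (_ : gPrimeOf G (Q' j) ∈ Ω), (Q' j).sections :=
    (iInf_sections_le hM hQ hQ' hΩ).antisymm (iInf_sections_le hM hQ' hQ (hrange ▸ hΩ))
  refine ⟨hrange, fun Ω _ => hinf Ω, fun i hi => ?_⟩
  obtain ⟨j, hj⟩ : gPrimeOf G (Q i) ∈ Set.range (fun j => gPrimeOf G (Q' j)) := hrange ▸ ⟨i, rfl⟩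
  refine ⟨j, hj, QCohSubmodule.ext ?_⟩
  -- Minimality makes the singleton a poset ideal, and distinctness of the `G`-primes leaves one
  -- component on each side.
  have h := hinf {gPrimeOf G (Q i)} fun P hP P' hP' hle => by
    rw [Set.mem_singleton_iff] at hP ⊢
    subst hP
    exact hle.antisymm (hi.2 hP' hle)
  have hiff (k : Fin r) : gPrimeOf G (Q k) ∈ ({gPrimeOf G (Q i)} : Set _) ↔ k = i :=
    hQ.injective.eq_iff
  have hiff' (k : Fin s) : gPrimeOf G (Q' k) ∈ ({gPrimeOf G (Q i)} : Set _) ↔ k = j := by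
    rw [← hj]
    exact hQ'.injective.eq_iff
  simpa only [hiff, hiff', iInf_iInf_eq_left] using h.symm
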